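/- Let $T>0$, let $N$ be a Poisson process on $[0,T]$ with intensity $\lambda>0$, independent of the i.i.d. positive square-integrable claims $Y_1,Y_2,\dots$ with distribution $F$, let $Y\sim F$, let $\tau_i$ be the arrival time of the $i$-th claim, and let $\gamma,\gamma_I>0$ and $x_C>0$. An admissible coverage is a measurable $l:[0,T]\times(0,\infty)\to\mathbb R$ with $0\le l(t,y)\le y$. For a risk loading $\xi\ge 0$ its premium rate is $p(t)=(1+\xi)\lambda\int l(t,y)\,\mathrm dF(y)$. The terminal surplus of a customer with surplus $x$ at time $t$ is $$X_C^{t,x}(T,l)=x-\int_t^T p(s)\,\mathrm ds-\sum_{i:\,t<\tau_i\le T}\bigl(Y_i-l(\tau_i,Y_i)\bigr),$$ and the insurer's terminal wealth is $X_I(T,l)=\int_0^T p(s)\,\mathrm ds-\sum_{i:\,\tau_i\le T} l(\tau_i,Y_i)$. Put $J(t,x,l)=\mathbb E[X_C^{t,x}(T,l)]-\frac{\gamma}{2}\mathrm{Var}[X_C^{t,x}(T,l)]$. An admissible $l$ is an equilibrium (optimal) response of the customer to $\xi$ if $\liminf_{\varepsilon\downarrow0}\varepsilon^{-1}\bigl(J(t,x,l)-J(t,x,l^{\varepsilon})\bigr)\ge0$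 for all $t\in[0,T]$, $x\in\mathbb R$ and all admissible perturbations $l^\varepsilon$, where $l^\varepsilon$ equals some $\bar l(y)$ for times in $[t,t+\varepsilon)$ and $l$ otherwise. The insurer knows the customer's risk aversion $\gamma$ (the type set is $\{\gamma\}$ and the prior is the point mass at $\gamma$, so the truth-telling constraint is trivially satisfied) and chooses a loading $\xi\ge0$, to which the customer responds optimally, so as to maximize $\mathbb E[X_I(T,l)]-\frac{\gamma_I}{2}\mathrm{Var}[X_I(T,l)]$. Let $$\phi(\xi)=\xi\,\mathbb E\Bigl[\Bigl(Y-\frac{\xi}{\gamma}\Bigr)_+\Bigr]-\frac{\gamma_I}{2}\,\mathbb E\Bigl[\Bigl(Y-\frac{\xi}{\gamma}\Bigr)_+^2\Bigr].$$ (1) If $\hat\xi$ maximizes $\phi$ over $[0,\infty)$, then the menu consisting of the single contract with coverage $\hat l(y)=\bigl(y-\hat\xi/\gamma\bigr)_+$ and premium rate $\hat p=(1+\hat\xi)\,\lambda\,\mathbb E\bigl[(Y-\hat\xi/\gamma)_+\bigr]$ is optimal for the insurer; moreover $\hat l$ also maximizes $J(0,x_C,\cdot)$ over all admissible coverages. (2)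 Conversely, for every optimal menu its loading $\hat\xi$ maximizes $\phi$ over $[0,\infty)$, its coverage equals $(y-\hat\xi/\gamma)_+$ for $\mathrm dt\otimes F$-almost every $(t,y)\in[0,T]\times(0,\infty)$, and its premium rate equals $(1+\hat\xi)\,\lambda\,\mathbb E\bigl[(Y-\hat\xi/\gamma)_+\bigr]$ for almost every $t\in[0,T]$. -/

import Mathlib

open Set Filter Topology MeasureTheory ProbabilityTheory
open scoped NNReal ENNReal

/-- A homogeneous Poisson process with intensity `r` on the finite horizon `[0, T]`: it starts at
zero, has nondecreasing right-continuous paths, and its increments are independent and Poisson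
distributed. -/
structure IsPoissonProcess {Ω : Type*} [MeasurableSpace Ω] (N : ℝ → Ω → ℕ) (r : ℝ≥0) (T : ℝ)
    (P : Measure Ω) : Prop where
  measurable : ∀ t ∈ Icc 0 T, Measurable (N t)
  zero : ∀ᵐ ω ∂P, N 0 ω = 0
  mono : ∀ᵐ ω ∂P, MonotoneOn (fun t => N t ω) (Icc 0 T)
  right_cont : ∀ᵐ ω ∂P, ∀ t ∈ Ico 0 T, ContinuousWithinAt (fun s => N s ω) (Ici t) t
  law : ∀ s t : ℝ, 0 ≤ s → s ≤ t → t ≤ T →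
    HasLaw (fun ω => N t ω - N s ω) (poissonMeasure (r * (t - s).toNNReal)) P
  indep : HasIndepIncrements (fun (t : Icc (0 : ℝ) T) => N t) P

/-- The Cramér–Lundberg insurance market: a probability space, a horizon `T > 0`, a Poisson claim
counting process with intensity `rate > 0`, positive square-integrable iid claim sizes (`Y i` is
the size of claim number `i + 1`) independent of the counting process, and the initial surplus
of the customer. -/
structure InsuranceModel (Ω : Type*) [MeasurableSpace Ω] where
  P : Measure Ω
  isProb : IsProbabilityMeasure P
  T : ℝ
  T_pos : 0 < T
  rate : ℝ≥0
  rate_pos : 0 < rate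
  N : ℝ → Ω → ℕ
  poisson : IsPoissonProcess N rate T P
  Y : ℕ → Ω → ℝ
  Y_measurable : ∀ i, Measurable (Y i)
  Y_iIndep : iIndepFun Y P
  Y_identDistrib : ∀ i, IdentDistrib (Y i) (Y 0) P P
  Y_pos : ∀ᵐ ω ∂P, 0 < Y 0 ω
  Y_memLp : MemLp (Y 0) 2 P
  indep : IndepFun (fun ω (t : Icc (0 : ℝ) T) => N t ω) (fun ω i => Y i ω) P
  xC : ℝ
  xC_pos : 0 < xC

attribute [instance] InsuranceModel.isProb

noncomputable section

namespace InsuranceModel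

variable {Ω : Type*} [MeasurableSpace Ω]

/-- The claim size distribution `F`. -/
def claimLaw (M : InsuranceModel Ω) : Measure ℝ := M.P.map (M.Y 0)

/-- The arrival time of claim number `i + 1`. -/
def claimTime (M : InsuranceModel Ω) (i : ℕ) (ω : Ω) : ℝ :=
  sInf {s | s ∈ Icc 0 M.T ∧ i < M.N s ω}

/-- The integral `∫_t^T ∫ h(s,y) N(ds,dy)`: the sum of `h` (arrival time) (claim size) over all
claims arriving in `(t, T]`. -/
def claimSum (M : InsuranceModel Ω) (t : ℝ) (h : ℝ → ℝ → ℝ) (ω : Ω) : ℝ :=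
  ∑ i ∈ Finset.Ico (M.N t ω) (M.N M.T ω), h (M.claimTime i ω) (M.Y i ω)

/-- Admissible loss coverages `l(t,y)`: measurable, with `0 ≤ l(t,y) ≤ y`. -/
def admissible (M : InsuranceModel Ω) : Set (ℝ → ℝ → ℝ) :=
  {l | Measurable (Function.uncurry l) ∧
    ∀ t ∈ Icc 0 M.T, ∀ y, 0 < y → 0 ≤ l t y ∧ l t y ≤ y}

/-- The expected-value premium principle: premium rate at time `t` for coverage `l` under the risk
loading `ξ`. -/
def premiumRate (M : InsuranceModel Ω) (ξ : ℝ) (l : ℝ → ℝ → ℝ) (t : ℝ) : ℝ :=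
  (1 + ξ) * M.rate * ∫ y, l t y ∂M.claimLaw

/-- Terminal surplus of the customer who has surplus `x` at time `t`. -/
def customerSurplus (M : InsuranceModel Ω) (ξ : ℝ) (l : ℝ → ℝ → ℝ) (t x : ℝ) (ω : Ω) : ℝ :=
  x - (∫ s in t..M.T, M.premiumRate ξ l s) - M.claimSum t (fun s y => y - l s y) ω

/-- Terminal wealth of the insurer. -/
def insurerWealth (M : InsuranceModel Ω) (ξ : ℝ) (l : ℝ → ℝ → ℝ) (ω : Ω) : ℝ :=
  (∫ s in (0 : ℝ)..M.T, M.premiumRate ξ l s) - M.claimSum 0 l ω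

/-- The mean-variance criterion with risk aversion `κ`. -/
def meanVariance (M : InsuranceModel Ω) (κ : ℝ) (X : Ω → ℝ) : ℝ :=
  (∫ ω, X ω ∂M.P) - κ / 2 * variance X M.P

/-- The customer's criterion `J(t,x,l)` for true risk aversion `γ` and loading `ξ`. Coverages are
deterministic and the claim process has independent increments, so conditioning on surplus `x` at
time `t` amounts to starting the surplus process from `x` at time `t`. -/
def customerCriterion (M : InsuranceModel Ω) (γ ξ t x : ℝ) (l : ℝ → ℝ → ℝ) : ℝ :=
  M.meanVariance γ (M.customerSurplus ξ l t x)

/-- The value function of a customer with risk aversion `γ` who is charged the loading `ξ`. -/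
def customerValue (M : InsuranceModel Ω) (γ ξ : ℝ) : ℝ :=
  sSup (M.customerCriterion γ ξ 0 M.xC '' M.admissible)

/-- The strategy `l` perturbed to `lbar` on `[t, t + ε)`. -/
def perturb (l : ℝ → ℝ → ℝ) (lbar : ℝ → ℝ) (t ε : ℝ) : ℝ → ℝ → ℝ :=
  open Classical in fun s y => if s ∈ Ico t (t + ε) then lbar y else l s y

/-- Equilibrium strategies of the customer (the notion of optimality for the time-inconsistent
mean-variance problem). -/
def IsEquilibrium (M : InsuranceModel Ω) (γ ξ : ℝ) (l : ℝ → ℝ → ℝ) : Prop :=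
  l ∈ M.admissible ∧
    ∀ t ∈ Icc 0 M.T, ∀ (x : ℝ) (lbar : ℝ → ℝ),
      (∀ ε > 0, perturb l lbar t ε ∈ M.admissible) →
      0 ≤ liminf (fun ε : ℝ => (((M.customerCriterion γ ξ t x l
        - M.customerCriterion γ ξ t x (perturb l lbar t ε)) / ε : ℝ) : EReal)) (𝓝[>] 0)

/-- The insurer's mean-variance utility from a coverage `l` sold at loading `ξ`. -/
def insurerUtility (M : InsuranceModel Ω) (γI ξ : ℝ) (l : ℝ → ℝ → ℝ) : ℝ :=
  M.meanVariance γI (M.insurerWealth ξ l)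

end InsuranceModel

/-- A menu: for each (reported) risk aversion a risk loading and the coverage taken at that
loading by the customer of that type. -/
structure Menu where
  loading : ℝ → ℝ
  coverage : ℝ → ℝ → ℝ → ℝ

namespace Menu

variable {Ω : Type*} [MeasurableSpace Ω]

/-- The contracts (coverage, premium rate) in the menu for types in `[γL, γH]`. -/
def contracts (m : Menu) (M : InsuranceModel Ω) (γL γH : ℝ) :
    Set ((ℝ → ℝ → ℝ) × (ℝ → ℝ)) :=
  (fun γ => (m.coverage γ, M.premiumRate (m.loading γ) (m.coverage γ))) '' Icc γL γH

/-- The constraints of the insurer's problem when the insurer's prior on the type is the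
distribution `G` on `[γL, γH]`: nonnegative loadings, customers respond optimally, truth-telling,
and the insurer's objective is well defined. -/
structure IsFeasible (m : Menu) (M : InsuranceModel Ω) (γI γL γH : ℝ) (G : Measure ℝ) :
    Prop where
  loading_nonneg : ∀ γ ∈ Icc γL γH, 0 ≤ m.loading γ
  response : ∀ γ ∈ Icc γL γH, M.IsEquilibrium γ (m.loading γ) (m.coverage γ)
  truth_telling : ∀ γ ∈ Icc γL γH,
    IsMaxOn (fun γ' => M.customerValue γ (m.loading γ')) (Icc γL γH) γ
  integrable : IntegrableOn (fun γ => M.insurerUtility γI (m.loading γ) (m.coverage γ))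
    (Icc γL γH) G

/-- The insurer's objective. -/
def objective (m : Menu) (M : InsuranceModel Ω) (γI γL γH : ℝ) (G : Measure ℝ) : ℝ :=
  ∫ γ in Icc γL γH, M.insurerUtility γI (m.loading γ) (m.coverage γ) ∂G

/-- `m` solves the insurer's problem. -/
def IsOptimal (m : Menu) (M : InsuranceModel Ω) (γI γL γH : ℝ) (G : Measure ℝ) : Prop :=
  m.IsFeasible M γI γL γH G ∧
    ∀ m' : Menu, m'.IsFeasible M γI γL γH G →
      m'.objective M γI γL γH G ≤ m.objective M γI γL γH G

end Menu

/-- The function `ξ ↦ ξ E[(Y - ξ/γ)_+] - (γI/2) E[(Y - ξ/γ)_+²]`. -/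
def loadingObjective {Ω : Type*} [MeasurableSpace Ω] (M : InsuranceModel Ω) (γ γI ξ : ℝ) : ℝ :=
  ξ * (∫ ω, max (M.Y 0 ω - ξ / γ) 0 ∂M.P)
    - γI / 2 * ∫ ω, (max (M.Y 0 ω - ξ / γ) 0) ^ 2 ∂M.P

end

/-! The claims form a Poisson random measure on `[0, T] × (0, ∞)` with intensity `rate · dt ⊗ F`, so
a sum of `g` over the claims after `t` has mean `rate ∫∫ g` and variance `rate ∫∫ g²`. Only these
two moments are needed. They come from the first and second factorial moment measures of the claims
(`intensity_eq_sum`, `intensity_prod_intensity_eq_sum`), which are identified on rectangles `(-∞, a]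
× s`, where `claimTime i ≤ a` is an event about `N a` alone.

With them the customer's criterion becomes `x - rate ∫_t^T cost (l s) ds` (`customerCriterion_eq`).
It is additive over time, so the mean-variance problem loses its time inconsistency. The cost
integrand is minimized pointwise in `y` by `(y - ξ/γ)₊`, with quadratic growth around the minimizer
(`sq_sub_deductible_le`). Hence the deductible is a global maximizer and an equilibrium. Conversely,
perturbing an equilibrium towards the deductible at points where the integrated cost is
differentiable forces equality almost everywhere (`IsEquilibrium.ae_eq_deductible`).

The insurer's utility from any equilibrium response is therefore `rate · T · φ(ξ)`. Under a
point-mass prior the truth-telling and integrability constraints are vacuous, so optimizing over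
menus is maximizing `φ`. -/

/-! ### Poisson factorial moments and counting of pairs. -/

/-- The factorial moments of the Poisson distribution. -/
theorem lintegral_descFactorial_poissonMeasure (r : ℝ≥0) (k : ℕ) :
    ∫⁻ n, (n.descFactorial k : ℝ≥0∞) ∂(poissonMeasure r) = (r : ℝ≥0∞) ^ k := by
  have h1 : ∫⁻ n, (n.descFactorial k : ℝ≥0∞) ∂(poissonMeasure r)
      = ∑' n, ENNReal.ofReal (Real.exp (-r) * r ^ n / n.factorial)
        * (n.descFactorial k : ℝ≥0∞) := by
    rw [poissonMeasure, lintegral_sum_measure]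
    simp [lintegral_smul_measure]
  -- The first `k` terms vanish with `descFactorial`; the shift by `k` turns the rest into `r ^ k`
  -- times the Poisson total mass.
  have h2 := (ENNReal.summable (f := fun n : ℕ =>
    ENNReal.ofReal (Real.exp (-r) * r ^ (n + k) / (n + k).factorial)
        * ((n + k).descFactorial k : ℝ≥0∞))).sum_add_tsum_nat_add' (k := k)
        (f := fun n : ℕ => ENNReal.ofReal (Real.exp (-r) * r ^ n / n.factorial)
        * (n.descFactorial k : ℝ≥0∞))
  rw [h1, ← h2, Finset.sum_eq_zero, zero_add]
  · have h3 : ∀ n : ℕ, ENNReal.ofReal (Real.exp (-r) * r ^ (n + k) / (n + k).factorial)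
        * ((n + k).descFactorial k : ℝ≥0∞)
        = ENNReal.ofReal (Real.exp (-r) * r ^ n / n.factorial) * (r : ℝ≥0∞) ^ k := by
      intro n
      rw [← ENNReal.ofReal_natCast, ← ENNReal.ofReal_coe_nnreal, ← ENNReal.ofReal_pow r.coe_nonneg,
        ← ENNReal.ofReal_mul (by positivity), ← ENNReal.ofReal_mul (by positivity)]
      congr 1
      have h4 : (n.factorial : ℝ) * (n + k).descFactorial k = (n + k).factorial := by
        have := Nat.factorial_mul_descFactorial (Nat.le_add_left k n)
        rw [Nat.add_sub_cancel] at this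
        exact_mod_cast this
      have h5 : (n.factorial : ℝ) ≠ 0 := by positivity
      have h6 : ((n + k).factorial : ℝ) ≠ 0 := by positivity
      field_simp
      linear_combination (r : ℝ) ^ (n + k) * h4
    simp_rw [h3, ENNReal.tsum_mul_right]
    rw [← ENNReal.ofReal_tsum_of_nonneg (fun n => by positivity)
      (hasSum_one_poissonMeasure r).summable, (hasSum_one_poissonMeasure r).tsum_eq]
    simp
  · intro n hn
    rw [Nat.descFactorial_eq_zero_iff_lt.2 (Finset.mem_range.1 hn)]
    simp

/-- Since `i < m ≤ n`, each `i` rules out exactly one `j < n`. The truncated `n - 1` is harmless: `n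
= 0` forces `m = 0`. -/
theorem ENNReal.tsum_offDiag_lt (m n : ℕ) (hmn : m ≤ n) :
    ∑' p : ℕ × ℕ, (if p.1 ≠ p.2 ∧ p.1 < m ∧ p.2 < n then 1 else 0 : ℝ≥0∞)
      = (m * (n - 1) : ℕ) := by
  refine (ENNReal.tsum_prod (f := fun i j : ℕ =>
    (if i ≠ j ∧ i < m ∧ j < n then 1 else 0 : ℝ≥0∞))).trans ?_
  rw [tsum_eq_sum (s := Finset.range m)]
  · rw [Nat.cast_mul, ← nsmul_eq_mul, ← Finset.card_range m, ← Finset.sum_const]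
    simp only [Finset.card_range]
    refine Finset.sum_congr rfl fun i hi => ?_
    have him := Finset.mem_range.1 hi
    rw [tsum_eq_sum (s := (Finset.range n).erase i)]
    · rw [Finset.sum_congr rfl (g := fun _ => 1)]
      · rw [Finset.sum_const, Finset.card_erase_of_mem (by simp; omega)]
        simp
      · intro j hj
        simp only [Finset.mem_erase, Finset.mem_range] at hj
        rw [if_pos ⟨hj.1.symm, him, hj.2⟩]
    · intro j hj
      rw [if_neg]
      simp only [Finset.mem_erase, Finset.mem_range] at hj
      tauto
  · intro i hi
    simp only [Finset.mem_range] at hi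
    simp [hi]

/-! ### Arrival times and moments of the counting process. -/

namespace InsuranceModel

variable {Ω : Type*} [MeasurableSpace Ω]

/-- The point of `[0, T]` closest to `a`. -/
noncomputable def clamp (M : InsuranceModel Ω) (a : ℝ) : ℝ := max 0 (min a M.T)

theorem clamp_mem (M : InsuranceModel Ω) (a : ℝ) : M.clamp a ∈ Icc 0 M.T :=
  ⟨le_max_left _ _, max_le M.T_pos.le (min_le_right _ _)⟩

theorem zero_mem (M : InsuranceModel Ω) : (0 : ℝ) ∈ Icc 0 M.T := ⟨le_rfl, M.T_pos.le⟩

theorem T_mem (M : InsuranceModel Ω) : M.T ∈ Icc 0 M.T := ⟨M.T_pos.le, le_rfl⟩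

theorem claimTime_mem (M : InsuranceModel Ω) {i : ℕ} {ω : Ω} (hi : i < M.N M.T ω) :
    M.claimTime i ω ∈ Icc 0 M.T :=
  ⟨le_csInf ⟨M.T, M.T_mem, hi⟩ fun _ hs => hs.1.1,
    csInf_le ⟨0, fun _ hs => hs.1.1⟩ ⟨M.T_mem, hi⟩⟩

/-- The arrival time is the generalized inverse of the path, and right-continuity makes the infimum
attained. Clamping lets `a` range over all reals, as half-line generators require. -/
theorem ae_claimTime_le_iff (M : InsuranceModel Ω) : ∀ᵐ ω ∂M.P, ∀ i a, i < M.N M.T ω →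
    (M.claimTime i ω ≤ a ↔ i < M.N (M.clamp a) ω) := by
  filter_upwards [M.poisson.zero, M.poisson.mono, M.poisson.right_cont] with ω h0 hm hc i a hi
  have hne : ({s | s ∈ Icc 0 M.T ∧ i < M.N s ω}).Nonempty := ⟨M.T, M.T_mem, hi⟩
  have hbd : BddBelow {s | s ∈ Icc 0 M.T ∧ i < M.N s ω} := ⟨0, fun _ hs => hs.1.1⟩
  have hmem := M.claimTime_mem hi
  constructor
  · intro hle
    have hτ : i < M.N (M.claimTime i ω) ω := by
      rcases hmem.2.eq_or_lt with h | h
      · rwa [h]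
      · have h1 := hc _ ⟨hmem.1, h⟩
        -- `ℕ` is discrete, so right-continuity means locally constant to the right.
        have h2 : ∀ᶠ s in 𝓝[≥] (M.claimTime i ω), M.N s ω = M.N (M.claimTime i ω) ω :=
          h1.eventually (by simp : ∀ᶠ n in 𝓝 (M.N (M.claimTime i ω) ω), n = _)
        obtain ⟨u, hu, hus⟩ := mem_nhdsGE_iff_exists_Ico_subset.1 h2
        obtain ⟨s, hs, hsu⟩ := exists_lt_of_csInf_lt hne (show sInf _ < u from hu)
        have := hus ⟨csInf_le hbd hs, hsu⟩
        simp only [mem_ofPred_eq] at this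
        rw [← this]
        exact hs.2
    refine hτ.trans_le (hm hmem (M.clamp_mem a) ?_)
    exact le_max_of_le_right (le_min hle hmem.2)
  · intro h
    refine (csInf_le hbd ⟨M.clamp_mem a, h⟩).trans ?_
    unfold clamp at *
    -- Failure would mean `a < 0`, so the clamp is `0`, where the path vanishes.
    by_contra! hlt
    have : max 0 (min a M.T) = 0 := by
      rcases le_total (min a M.T) 0 with h' | h'
      · exact max_eq_left h'
      · rw [max_eq_right h'] at hlt
        exact absurd hlt (not_lt.2 (min_le_left _ _))
    rw [this, h0] at h
    omega

theorem clamp_of_mem (M : InsuranceModel Ω) {a : ℝ} (ha : a ∈ Icc 0 M.T) : M.clamp a = a := by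
  rw [clamp, min_eq_left ha.2, max_eq_right ha.1]

theorem ae_N_le (M : InsuranceModel Ω) {a b : ℝ} (ha : a ∈ Icc 0 M.T) (hb : b ∈ Icc 0 M.T)
    (hab : a ≤ b) : ∀ᵐ ω ∂M.P, M.N a ω ≤ M.N b ω := by
  filter_upwards [M.poisson.mono] with ω h using h ha hb hab

theorem aemeasurable_claimTime (M : InsuranceModel Ω) (i : ℕ) :
    AEMeasurable (M.claimTime i) M.P := by
  -- Path regularity holds only almost surely, so sublevel sets are identified up to null sets, in
  -- the completed σ-algebra.
  suffices h : NullMeasurable (M.claimTime i) M.P from h.aemeasurable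
  refine fun s hs => @measurable_of_Iic ℝ (NullMeasurableSpace Ω M.P) _ _ _ _ _ _ _ _
    (fun a => ?_) s hs
  -- The second alternative accounts for claims that never arrive: their time is `sInf ∅ = 0`.
  have hm : MeasurableSet {ω | (i < M.N M.T ω ∧ i < M.N (M.clamp a) ω) ∨
      (M.N M.T ω ≤ i ∧ 0 ≤ a)} := by
    have h1 := M.poisson.measurable _ M.T_mem
    have h2 := M.poisson.measurable _ (M.clamp_mem a)
    measurability
  refine hm.nullMeasurableSet.congr ?_
  refine Filter.eventuallyEq_set.2 ?_
  filter_upwards [M.ae_claimTime_le_iff, M.poisson.mono] with ω hω hmono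
  change ((i < M.N M.T ω ∧ i < M.N (M.clamp a) ω) ∨ (M.N M.T ω ≤ i ∧ 0 ≤ a)) ↔
      M.claimTime i ω ≤ a
  by_cases hi : i < M.N M.T ω
  · rw [hω i a hi]
    constructor
    · rintro (h | h)
      · exact h.2
      · omega
    · exact fun h => Or.inl ⟨hi, h⟩
  · have h0 : M.claimTime i ω = 0 := by
      have : {s | s ∈ Icc 0 M.T ∧ i < M.N s ω} = ∅ :=
        eq_empty_of_forall_notMem fun s hs => hi (hs.2.trans_le (hmono hs.1 M.T_mem hs.1.2))
      rw [claimTime, this, Real.sInf_empty]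
    rw [h0]
    simp [hi, not_lt.1 hi]

theorem hasLaw_N (M : InsuranceModel Ω) {a : ℝ} (ha : a ∈ Icc 0 M.T) :
    HasLaw (M.N a) (poissonMeasure (M.rate * a.toNNReal)) M.P := by
  have := M.poisson.law 0 a le_rfl ha.1 ha.2
  rw [sub_zero] at this
  refine this.congr ?_
  filter_upwards [M.poisson.zero] with ω h
  simp [h]

theorem lintegral_N (M : InsuranceModel Ω) {a : ℝ} (ha : a ∈ Icc 0 M.T) :
    ∫⁻ ω, (M.N a ω : ℝ≥0∞) ∂M.P = M.rate * ENNReal.ofReal a := by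
  have := lintegral_descFactorial_poissonMeasure (M.rate * a.toNNReal) 1
  rw [← (M.hasLaw_N ha).lintegral_comp (f := fun n => (n.descFactorial 1 : ℝ≥0∞))
    (by fun_prop)] at this
  simpa [ENNReal.ofReal] using this

theorem lintegral_N_mul_pred (M : InsuranceModel Ω) {a b : ℝ} (ha : a ∈ Icc 0 M.T)
    (hb : b ∈ Icc 0 M.T) (hab : a ≤ b) :
    ∫⁻ ω, ((M.N a ω * (M.N b ω - 1) : ℕ) : ℝ≥0∞) ∂M.P
      = (M.rate * ENNReal.ofReal a) * (M.rate * ENNReal.ofReal b) := by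
  have hma := M.poisson.measurable _ ha
  have hmb := M.poisson.measurable _ hb
  -- `N_a (N_b - 1) = N_a (N_a - 1) + N_a (N_b - N_a)`: a factorial moment plus a product of
  -- independent increments.
  have h1 : ∫⁻ ω, ((M.N a ω * (M.N b ω - 1) : ℕ) : ℝ≥0∞) ∂M.P
      = ∫⁻ ω, (((M.N a ω).descFactorial 2 : ℕ) : ℝ≥0∞)
        + (M.N a ω : ℝ≥0∞) * ((M.N b ω - M.N a ω : ℕ) : ℝ≥0∞) ∂M.P := by
    refine lintegral_congr_ae ?_
    filter_upwards [M.ae_N_le ha hb hab] with ω hω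
    norm_cast
    obtain ⟨c, hc⟩ := Nat.exists_eq_add_of_le hω
    rcases h : M.N a ω with _ | k
    · simp
    · rw [h] at hc
      rw [hc]
      have e1 : k + 1 + c - 1 = k + c := by omega
      have e2 : k + 1 + c - (k + 1) = c := by omega
      rw [e1, e2]
      simp [Nat.descFactorial]
      ring
  rw [h1, lintegral_add_left (by fun_prop)]
  have h2 := lintegral_descFactorial_poissonMeasure (M.rate * a.toNNReal) 2
  rw [← (M.hasLaw_N ha).lintegral_comp (f := fun n => (n.descFactorial 2 : ℝ≥0∞))
    (by fun_prop)] at h2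
  have h3 : IndepFun (M.N a) (fun ω => M.N b ω - M.N a ω) M.P := by
    have := M.poisson.indep.indepFun_sub_sub (r := ⟨0, M.zero_mem⟩) (s := ⟨a, ha⟩) (t := ⟨b, hb⟩)
      ha.1 hab
    refine this.congr ?_ .rfl
    filter_upwards [M.poisson.zero] with ω h
    simp [h]
  have h4 := lintegral_mul_eq_lintegral_mul_lintegral_of_indepFun (μ := M.P)
    (f := fun ω => (M.N a ω : ℝ≥0∞)) (g := fun ω => ((M.N b ω - M.N a ω : ℕ) : ℝ≥0∞))
    (by fun_prop) (by fun_prop)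
    (h3.comp (φ := fun n : ℕ => (n : ℝ≥0∞)) (ψ := fun n : ℕ => (n : ℝ≥0∞))
      (by fun_prop) (by fun_prop))
  have h5 := lintegral_descFactorial_poissonMeasure (M.rate * (b - a).toNNReal) 1
  rw [← (M.poisson.law a b ha.1 hab hb.2).lintegral_comp
    (f := fun n => (n.descFactorial 1 : ℝ≥0∞)) (by fun_prop)] at h5
  simp only [Nat.descFactorial_one, pow_one] at h5
  simp only [Pi.mul_apply] at h4
  rw [h2, h4, h5, M.lintegral_N ha]
  have h6 : ENNReal.ofReal b = ENNReal.ofReal a + ENNReal.ofReal (b - a) := by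
    rw [← ENNReal.ofReal_add ha.1 (by linarith)]; congr 1; ring
  rw [h6]
  simp only [ENNReal.ofReal, ENNReal.coe_mul]
  ring

/-- The sum is the expected number of ordered pairs of distinct claims by times `a` and `b`.
Distinct endpoints are needed to test the second moment measure on products of half-lines. -/
theorem tsum_measure_offDiag (M : InsuranceModel Ω) {a b : ℝ} (ha : a ∈ Icc 0 M.T)
    (hb : b ∈ Icc 0 M.T) :
    ∑' p : ℕ × ℕ, M.P {ω | p.1 ≠ p.2 ∧ p.1 < M.N a ω ∧ p.2 < M.N b ω}
      = (M.rate * ENNReal.ofReal a) * (M.rate * ENNReal.ofReal b) := by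
  wlog hab : a ≤ b generalizing a b
  · rw [mul_comm, ← this hb ha (le_of_not_ge hab), ← (Equiv.prodComm ℕ ℕ).tsum_eq]
    refine tsum_congr fun p => ?_
    congr 1
    ext ω
    simp only [Equiv.prodComm_apply, Prod.fst_swap, Prod.snd_swap, mem_ofPred_eq]
    tauto
  have hma := M.poisson.measurable _ ha
  have hmb := M.poisson.measurable _ hb
  have hms : ∀ p : ℕ × ℕ, MeasurableSet {ω | p.1 ≠ p.2 ∧ p.1 < M.N a ω ∧ p.2 < M.N b ω} :=
    fun p => (MeasurableSet.const _).inter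
      ((measurableSet_lt measurable_const hma).inter (measurableSet_lt measurable_const hmb))
  rw [← M.lintegral_N_mul_pred ha hb hab]
  calc _ = ∑' p : ℕ × ℕ, ∫⁻ ω, ({ω | p.1 ≠ p.2 ∧ p.1 < M.N a ω ∧ p.2 < M.N b ω}.indicator
        (fun _ => (1 : ℝ≥0∞))) ω ∂M.P := by
        refine tsum_congr fun p => ?_
        rw [lintegral_indicator (hms p)]; simp
    _ = ∫⁻ ω, ∑' p : ℕ × ℕ, ({ω | p.1 ≠ p.2 ∧ p.1 < M.N a ω ∧ p.2 < M.N b ω}.indicator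
        (fun _ => (1 : ℝ≥0∞))) ω ∂M.P :=
        (lintegral_tsum fun p => (measurable_const.indicator (hms p)).aemeasurable).symm
    _ = _ := by
        refine lintegral_congr_ae ?_
        filter_upwards [M.ae_N_le ha hb hab] with ω hω
        rw [← ENNReal.tsum_offDiag_lt _ _ hω]
        refine tsum_congr fun p => ?_
        simp only [indicator, mem_ofPred_eq]

theorem tsum_measure_lt_N (M : InsuranceModel Ω) {a : ℝ} (ha : a ∈ Icc 0 M.T) :
    ∑' i : ℕ, M.P {ω | i < M.N a ω} = M.rate * ENNReal.ofReal a := by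
  have hma := M.poisson.measurable _ ha
  have hms : ∀ i : ℕ, MeasurableSet {ω | i < M.N a ω} :=
    fun p => measurableSet_lt measurable_const hma
  rw [← M.lintegral_N ha]
  calc _ = ∑' i : ℕ, ∫⁻ ω, ({ω | i < M.N a ω}.indicator (fun _ => (1 : ℝ≥0∞))) ω ∂M.P := by
        refine tsum_congr fun p => ?_
        rw [lintegral_indicator (hms p)]; simp
    _ = ∫⁻ ω, ∑' i : ℕ, ({ω | i < M.N a ω}.indicator (fun _ => (1 : ℝ≥0∞))) ω ∂M.P :=
        (lintegral_tsum fun p => (measurable_const.indicator (hms p)).aemeasurable).symm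
    _ = _ := by
        refine lintegral_congr fun ω => ?_
        rw [tsum_eq_sum (s := Finset.range (M.N a ω)), Finset.sum_congr rfl (g := fun _ => 1)]
        · simp
        · intro i hi; simpa [indicator] using hi
        · intro i hi; simpa [indicator] using hi

end InsuranceModel

/-! ### Factorial moment measures and Campbell's formulas. -/

namespace InsuranceModel

variable {Ω : Type*} [MeasurableSpace Ω]

/-- Arrival time and size of claim number `i + 1`. -/
noncomputable def claimPoint (M : InsuranceModel Ω) (i : ℕ) (ω : Ω) : ℝ × ℝ :=
  (M.claimTime i ω, M.Y i ω)

/-- The intensity measure of the claims on `[0, T] × ℝ`. -/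
noncomputable def intensity (M : InsuranceModel Ω) : Measure (ℝ × ℝ) :=
  ((M.rate : ℝ≥0∞) • volume.restrict (Icc 0 M.T)).prod M.claimLaw

instance (M : InsuranceModel Ω) : IsProbabilityMeasure M.claimLaw :=
  Measure.isProbabilityMeasure_map (M.Y_measurable 0).aemeasurable

theorem map_Y (M : InsuranceModel Ω) (i : ℕ) : M.P.map (M.Y i) = M.claimLaw :=
  (M.Y_identDistrib i).map_eq

theorem measure_Y_preimage (M : InsuranceModel Ω) (i : ℕ) {s : Set ℝ} (hs : MeasurableSet s) :
    M.P (M.Y i ⁻¹' s) = M.claimLaw s := by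
  rw [← M.map_Y i, Measure.map_apply (M.Y_measurable i) hs]

theorem aemeasurable_claimPoint (M : InsuranceModel Ω) (i : ℕ) :
    AEMeasurable (M.claimPoint i) M.P :=
  (M.aemeasurable_claimTime i).prodMk (M.Y_measurable i).aemeasurable

instance (M : InsuranceModel Ω) :
    IsFiniteMeasure ((M.rate : ℝ≥0∞) • volume.restrict (Icc 0 M.T)) :=
  Measure.smul_finite _ ENNReal.coe_ne_top

instance (M : InsuranceModel Ω) : IsFiniteMeasure M.intensity := by
  unfold intensity; infer_instance

theorem volume_Iic_clamp (M : InsuranceModel Ω) (a : ℝ) :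
    ((M.rate : ℝ≥0∞) • volume.restrict (Icc 0 M.T)) (Iic a)
      = M.rate * ENNReal.ofReal (M.clamp a) := by
  rw [Measure.smul_apply, Measure.restrict_apply measurableSet_Iic, smul_eq_mul]
  congr 1
  have : Iic a ∩ Icc 0 M.T = Icc 0 (min a M.T) := by
    ext x; simp only [mem_inter_iff, mem_Iic, mem_Icc, le_min_iff]; tauto
  rw [this, Real.volume_Icc, clamp, sub_zero]
  rcases le_total 0 (min a M.T) with h | h
  · rw [max_eq_right h]
  · rw [max_eq_left h, ENNReal.ofReal_of_nonpos h, ENNReal.ofReal_zero]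

/-- Half-lines `(-∞, n]` exhaust the real line. -/
noncomputable def spanningIic (μ : Measure ℝ) [IsFiniteMeasure μ] :
    μ.FiniteSpanningSetsIn (range Iic) where
  set n := Iic (n : ℝ)
  set_mem n := ⟨n, rfl⟩
  finite n := measure_lt_top _ _
  spanning := iUnion_eq_univ_iff.2 fun x => by
    obtain ⟨n, hn⟩ := exists_nat_ge x
    exact ⟨n, hn⟩

theorem indepFun_N_Y (M : InsuranceModel Ω) {a b : ℝ} (ha : a ∈ Icc 0 M.T) (hb : b ∈ Icc 0 M.T)
    (i j : ℕ) : IndepFun (fun ω => (M.N a ω, M.N b ω)) (fun ω => (M.Y i ω, M.Y j ω)) M.P :=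
  M.indep.comp (φ := fun p : (Icc (0 : ℝ) M.T → ℕ) => (p ⟨a, ha⟩, p ⟨b, hb⟩))
    (ψ := fun y : ℕ → ℝ => (y i, y j)) (by fun_prop) (by fun_prop)

theorem ae_claimTime_mem_Iic_iff (M : InsuranceModel Ω) : ∀ᵐ ω ∂M.P, ∀ i a,
    (i < M.N M.T ω ∧ M.claimTime i ω ∈ Iic a) ↔ i < M.N (M.clamp a) ω := by
  filter_upwards [M.ae_claimTime_le_iff, M.poisson.mono] with ω h hm i a
  constructor
  · rintro ⟨h1, h2⟩
    exact (h i a h1).1 h2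
  · intro h2
    have h1 := h2.trans_le (hm (M.clamp_mem a) M.T_mem (M.clamp_mem a).2)
    exact ⟨h1, (h i a h1).2 h2⟩

theorem measurableSet_lt_N (M : InsuranceModel Ω) (i : ℕ) {a : ℝ} (ha : a ∈ Icc 0 M.T) :
    MeasurableSet {ω | i < M.N a ω} :=
  measurableSet_lt measurable_const (M.poisson.measurable _ ha)

/-- The intensity measure is the mean measure of the point process of claims. -/
theorem intensity_eq_sum (M : InsuranceModel Ω) :
    M.intensity = Measure.sum fun i =>
      (M.P.restrict {ω | i < M.N M.T ω}).map (M.claimPoint i) := by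
  refine Measure.prod_eq_generateFrom (borel_eq_generateFrom_Iic ℝ).symm
    MeasurableSpace.generateFrom_measurableSet isPiSystem_Iic MeasurableSpace.isPiSystem_measurableSet
    (spanningIic _) (Measure.toFiniteSpanningSetsIn _) ?_
  rintro _ ⟨a, rfl⟩ s hs
  simp only [mem_ofPred_eq] at hs
  rw [Measure.sum_apply _ (measurableSet_Iic.prod hs), volume_Iic_clamp,
    ← M.tsum_measure_lt_N (M.clamp_mem a), ← ENNReal.tsum_mul_right]
  refine tsum_congr fun i => ?_
  rw [Measure.map_apply_of_aemeasurable (M.aemeasurable_claimPoint i).restrict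
    (measurableSet_Iic.prod hs), Measure.restrict_apply' (M.measurableSet_lt_N i M.T_mem)]
  -- On a rectangle the time condition is an event about `N` alone, so it factors from the claim
  -- size.
  have h := (M.indepFun_N_Y (M.clamp_mem a) (M.clamp_mem a) i i).measure_inter_preimage_eq_mul
    {n | i < n.1} {y | y.1 ∈ s} (by measurability) (by measurability)
  rw [← M.measure_Y_preimage i hs]
  refine Eq.trans (measure_congr (Filter.eventuallyEq_set.2 ?_)) h
  filter_upwards [M.ae_claimTime_mem_Iic_iff] with ω hω
  have := hω i a
  simp only [mem_inter_iff, mem_preimage, mem_prod, mem_ofPred_eq, claimPoint]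
  rw [← this]
  tauto

/-- The second factorial moment measure of the point process of claims is the product of the
intensity measure with itself. -/
theorem intensity_prod_intensity_eq_sum (M : InsuranceModel Ω) :
    M.intensity.prod M.intensity = Measure.sum fun p : ℕ × ℕ =>
      (M.P.restrict {ω | p.1 ≠ p.2 ∧ p.1 < M.N M.T ω ∧ p.2 < M.N M.T ω}).map
        (fun ω => (M.claimPoint p.1 ω, M.claimPoint p.2 ω)) := by
  have hgen : MeasurableSpace.generateFrom
      (image2 (· ×ˢ ·) (range (Iic : ℝ → Set ℝ)) {s : Set ℝ | MeasurableSet s})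
      = Prod.instMeasurableSpace :=
    generateFrom_eq_prod (borel_eq_generateFrom_Iic ℝ).symm MeasurableSpace.generateFrom_measurableSet
      ⟨_, (spanningIic (0 : Measure ℝ)).set_mem, (spanningIic (0 : Measure ℝ)).spanning⟩
      isCountablySpanning_measurableSet
  have hpi : IsPiSystem
      (image2 (· ×ˢ ·) (range (Iic : ℝ → Set ℝ)) {s : Set ℝ | MeasurableSet s}) :=
    isPiSystem_Iic.prod MeasurableSpace.isPiSystem_measurableSet
  have hspan : M.intensity.FiniteSpanningSetsIn
      (image2 (· ×ˢ ·) (range (Iic : ℝ → Set ℝ)) {s : Set ℝ | MeasurableSet s}) :=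
    (spanningIic _).prod (Measure.toFiniteSpanningSetsIn _)
  refine Measure.prod_eq_generateFrom hgen hgen hpi hpi hspan hspan ?_
  rintro _ ⟨_, ⟨a, rfl⟩, s, hs, rfl⟩ _ ⟨_, ⟨b, rfl⟩, t, ht, rfl⟩
  simp only [mem_ofPred_eq] at hs ht
  have hm1 := (measurableSet_Iic (a := a)).prod hs
  have hm2 := (measurableSet_Iic (a := b)).prod ht
  rw [Measure.sum_apply _ (hm1.prod hm2), intensity, Measure.prod_prod, Measure.prod_prod,
    volume_Iic_clamp, volume_Iic_clamp, mul_mul_mul_comm,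
    ← M.tsum_measure_offDiag (M.clamp_mem a) (M.clamp_mem b), ← ENNReal.tsum_mul_right]
  refine tsum_congr fun p => ?_
  have hm : MeasurableSet {ω | p.1 ≠ p.2 ∧ p.1 < M.N M.T ω ∧ p.2 < M.N M.T ω} :=
    (MeasurableSet.const _).inter
      ((M.measurableSet_lt_N _ M.T_mem).inter (M.measurableSet_lt_N _ M.T_mem))
  rw [Measure.map_apply_of_aemeasurable ((M.aemeasurable_claimPoint p.1).prodMk
    (M.aemeasurable_claimPoint p.2)).restrict (hm1.prod hm2), Measure.restrict_apply' hm]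
  by_cases hp : p.1 = p.2
  · simp [hp]
  have h := (M.indepFun_N_Y (M.clamp_mem a) (M.clamp_mem b) p.1 p.2).measure_inter_preimage_eq_mul
    {n | p.1 ≠ p.2 ∧ p.1 < n.1 ∧ p.2 < n.2} {y | y.1 ∈ s ∧ y.2 ∈ t} (by measurability)
    (by measurability)
  -- Off the diagonal the two claim sizes are independent as well.
  have h' := (M.Y_iIndep.indepFun hp).measure_inter_preimage_eq_mul s t hs ht
  rw [← M.measure_Y_preimage p.1 hs, ← M.measure_Y_preimage p.2 ht, ← h']
  refine Eq.trans (measure_congr (Filter.eventuallyEq_set.2 ?_)) h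
  filter_upwards [M.ae_claimTime_mem_Iic_iff] with ω hω
  have h1 := hω p.1 a
  have h2 := hω p.2 b
  simp only [mem_inter_iff, mem_preimage, mem_prod, mem_ofPred_eq, claimPoint]
  rw [← h1, ← h2]
  tauto

/-- The sum of `H` over all claims, as a series. -/
noncomputable def claimSeries (M : InsuranceModel Ω) (H : ℝ × ℝ → ℝ≥0∞) (ω : Ω) : ℝ≥0∞ :=
  ∑' i, {ω | i < M.N M.T ω}.indicator (fun ω => H (M.claimPoint i ω)) ω

theorem aemeasurable_claimSeries_term (M : InsuranceModel Ω) {H : ℝ × ℝ → ℝ≥0∞}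
    (hH : Measurable H) (i : ℕ) :
    AEMeasurable ({ω | i < M.N M.T ω}.indicator (fun ω => H (M.claimPoint i ω))) M.P :=
  (hH.comp_aemeasurable (M.aemeasurable_claimPoint i)).indicator (M.measurableSet_lt_N i M.T_mem)

theorem aemeasurable_claimSeries (M : InsuranceModel Ω) {H : ℝ × ℝ → ℝ≥0∞}
    (hH : Measurable H) : AEMeasurable (M.claimSeries H) M.P :=
  AEMeasurable.tsum fun i => M.aemeasurable_claimSeries_term hH i

/-- Campbell's formula. -/
theorem lintegral_claimSeries (M : InsuranceModel Ω) {H : ℝ × ℝ → ℝ≥0∞} (hH : Measurable H) :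
    ∫⁻ ω, M.claimSeries H ω ∂M.P = ∫⁻ p, H p ∂M.intensity := by
  unfold claimSeries
  rw [lintegral_tsum fun i => M.aemeasurable_claimSeries_term hH i, intensity_eq_sum,
    lintegral_sum_measure]
  refine tsum_congr fun i => ?_
  rw [lintegral_map' hH.aemeasurable (M.aemeasurable_claimPoint i).restrict,
    lintegral_indicator (M.measurableSet_lt_N i M.T_mem)]

theorem _root_.ENNReal.tsum_sq (a : ℕ → ℝ≥0∞) :
    (∑' i, a i) ^ 2 = ∑' i, a i ^ 2 + ∑' p : ℕ × ℕ, if p.1 ≠ p.2 then a p.1 * a p.2 else 0 := by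
  have h : ∀ i, a i ^ 2 = ∑' j, if i = j then a i * a j else 0 := by
    intro i
    rw [tsum_eq_single i fun j hj => if_neg hj.symm, if_pos rfl, sq]
  rw [sq, ENNReal.tsum_prod (f := fun i j : ℕ => if i ≠ j then a i * a j else 0),
    ← ENNReal.tsum_add, ← ENNReal.tsum_mul_right]
  refine tsum_congr fun i => ?_
  rw [h i, ← ENNReal.tsum_add, ← ENNReal.tsum_mul_left]
  refine tsum_congr fun j => ?_
  by_cases hij : i = j <;> simp [hij]

/-- Squaring splits into diagonal and off-diagonal terms. The diagonal is Campbell's formula for `H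
^ 2`; the rest integrates `H ⊗ H` against the second factorial moment measure, which is a product.
-/
theorem lintegral_claimSeries_sq (M : InsuranceModel Ω) {H : ℝ × ℝ → ℝ≥0∞} (hH : Measurable H) :
    ∫⁻ ω, M.claimSeries H ω ^ 2 ∂M.P
      = ∫⁻ p, H p ^ 2 ∂M.intensity + (∫⁻ p, H p ∂M.intensity) ^ 2 := by
  unfold claimSeries
  simp_rw [ENNReal.tsum_sq]
  have hm : ∀ p : ℕ × ℕ, MeasurableSet {ω | p.1 ≠ p.2 ∧ p.1 < M.N M.T ω ∧ p.2 < M.N M.T ω} :=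
    fun p => (MeasurableSet.const _).inter
      ((M.measurableSet_lt_N _ M.T_mem).inter (M.measurableSet_lt_N _ M.T_mem))
  have hp : ∀ p : ℕ × ℕ, AEMeasurable (fun ω => (M.claimPoint p.1 ω, M.claimPoint p.2 ω)) M.P :=
    fun p => (M.aemeasurable_claimPoint p.1).prodMk (M.aemeasurable_claimPoint p.2)
  have hH2 : Measurable fun q : (ℝ × ℝ) × ℝ × ℝ => H q.1 * H q.2 := by fun_prop
  rw [lintegral_add_left' (AEMeasurable.tsum fun i =>
    (M.aemeasurable_claimSeries_term hH i).pow_const 2)]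
  congr 1
  · rw [← M.lintegral_claimSeries (hH.pow_const 2)]
    refine lintegral_congr fun ω => tsum_congr fun i => ?_
    by_cases hi : i < M.N M.T ω <;> simp [indicator, hi]
  · rw [sq, ← lintegral_prod_mul hH.aemeasurable hH.aemeasurable,
      intensity_prod_intensity_eq_sum, lintegral_sum_measure]
    have hterm : ∀ p : ℕ × ℕ, (fun ω => if p.1 ≠ p.2 then
        {ω | p.1 < M.N M.T ω}.indicator (fun ω => H (M.claimPoint p.1 ω)) ω *
          {ω | p.2 < M.N M.T ω}.indicator (fun ω => H (M.claimPoint p.2 ω)) ω else 0)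
        = {ω | p.1 ≠ p.2 ∧ p.1 < M.N M.T ω ∧ p.2 < M.N M.T ω}.indicator
          (fun ω => H (M.claimPoint p.1 ω) * H (M.claimPoint p.2 ω)) := by
      intro p
      ext ω
      by_cases h0 : p.1 = p.2 <;> by_cases h1 : p.1 < M.N M.T ω <;>
        by_cases h2 : p.2 < M.N M.T ω <;> simp [indicator, h0, h1, h2]
    have hmeas : ∀ p : ℕ × ℕ, AEMeasurable
        ({ω | p.1 ≠ p.2 ∧ p.1 < M.N M.T ω ∧ p.2 < M.N M.T ω}.indicator
          (fun ω => H (M.claimPoint p.1 ω) * H (M.claimPoint p.2 ω))) M.P :=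
      fun p => (hH2.comp_aemeasurable (hp p)).indicator (hm p)
    rw [lintegral_tsum fun p => by rw [hterm]; exact hmeas p]
    refine tsum_congr fun p => ?_
    rw [hterm, lintegral_indicator (hm p), lintegral_map' hH2.aemeasurable (hp p).restrict]

end InsuranceModel

/-! ### Mean and variance of claim sums. -/

namespace InsuranceModel

variable {Ω : Type*} [MeasurableSpace Ω]

theorem ae_claimLaw_pos (M : InsuranceModel Ω) : ∀ᵐ y ∂M.claimLaw, 0 < y := by
  rw [claimLaw, ae_map_iff (M.Y_measurable 0).aemeasurable measurableSet_Ioi]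
  exact M.Y_pos

theorem ae_Y_pos (M : InsuranceModel Ω) : ∀ᵐ ω ∂M.P, ∀ i, 0 < M.Y i ω := by
  refine ae_all_iff.2 fun i => ?_
  have := M.ae_claimLaw_pos
  rw [← M.map_Y i, ae_map_iff (M.Y_measurable i).aemeasurable measurableSet_Ioi] at this
  exact this

theorem memLp_id_claimLaw (M : InsuranceModel Ω) : MemLp (fun y : ℝ => y) 2 M.claimLaw := by
  rw [claimLaw, memLp_map_measure_iff (by fun_prop) (M.Y_measurable 0).aemeasurable]
  exact M.Y_memLp

theorem integrable_id_claimLaw (M : InsuranceModel Ω) :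
    Integrable (fun y : ℝ => y) M.claimLaw :=
  M.memLp_id_claimLaw.integrable (by norm_num)

theorem integrable_sq_claimLaw (M : InsuranceModel Ω) :
    Integrable (fun y : ℝ => y ^ 2) M.claimLaw :=
  M.memLp_id_claimLaw.integrable_sq

/-- A function of arrival time and claim size that is nonnegative and dominated by a function of
the claim size which is integrable with respect to the claim size distribution. -/
structure Dominated (M : InsuranceModel Ω) (g : ℝ → ℝ → ℝ) (C : ℝ → ℝ) : Prop where
  measurable : Measurable (Function.uncurry g)
  integrable_bound : Integrable C M.claimLaw
  nonneg : ∀ s ∈ Icc 0 M.T, ∀ y, 0 < y → 0 ≤ g s y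
  le : ∀ s ∈ Icc 0 M.T, ∀ y, 0 < y → g s y ≤ C y

namespace Dominated

variable {M : InsuranceModel Ω} {g : ℝ → ℝ → ℝ} {C : ℝ → ℝ}

theorem ae_nonneg (h : M.Dominated g C) {s : ℝ} (hs : s ∈ Icc 0 M.T) :
    0 ≤ᵐ[M.claimLaw] g s := by
  filter_upwards [M.ae_claimLaw_pos] with y hy using h.nonneg s hs y hy

theorem integrable (h : M.Dominated g C) {s : ℝ} (hs : s ∈ Icc 0 M.T) :
    Integrable (g s) M.claimLaw := by
  refine h.integrable_bound.mono' (h.measurable.of_uncurry_left).aestronglyMeasurable ?_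
  filter_upwards [M.ae_claimLaw_pos] with y hy
  rw [Real.norm_of_nonneg (h.nonneg s hs y hy)]
  exact h.le s hs y hy

theorem integral_nonneg (h : M.Dominated g C) {s : ℝ} (hs : s ∈ Icc 0 M.T) :
    0 ≤ ∫ y, g s y ∂M.claimLaw :=
  integral_nonneg_of_ae (h.ae_nonneg hs)

theorem integral_le (h : M.Dominated g C) {s : ℝ} (hs : s ∈ Icc 0 M.T) :
    ∫ y, g s y ∂M.claimLaw ≤ ∫ y, C y ∂M.claimLaw := by
  refine integral_mono_ae (h.integrable hs) h.integrable_bound ?_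
  filter_upwards [M.ae_claimLaw_pos] with y hy using h.le s hs y hy

theorem measurable_integral (h : M.Dominated g C) :
    Measurable fun s => ∫ y, g s y ∂M.claimLaw :=
  (h.measurable.stronglyMeasurable.integral_prod_right').measurable

theorem integrableOn (h : M.Dominated g C) :
    IntegrableOn (fun s => ∫ y, g s y ∂M.claimLaw) (Icc 0 M.T) := by
  refine Measure.integrableOn_of_bounded (M := ∫ y, C y ∂M.claimLaw) (by simp)
    h.measurable_integral.aestronglyMeasurable ?_
  filter_upwards [ae_restrict_mem measurableSet_Icc] with s hs
  rw [Real.norm_of_nonneg (h.integral_nonneg hs)]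
  exact h.integral_le hs

theorem intervalIntegrable (h : M.Dominated g C) {t u : ℝ} (ht : t ∈ Icc 0 M.T)
    (hu : u ∈ Icc 0 M.T) :
    IntervalIntegrable (fun s => ∫ y, g s y ∂M.claimLaw) volume t u :=
  (h.integrableOn.mono_set (uIcc_subset_Icc ht hu)).intervalIntegrable

theorem intervalIntegral_nonneg (h : M.Dominated g C) {t : ℝ} (ht : t ∈ Icc 0 M.T) :
    0 ≤ ∫ s in t..M.T, ∫ y, g s y ∂M.claimLaw :=
  intervalIntegral.integral_nonneg ht.2 fun _ hs => h.integral_nonneg ⟨ht.1.trans hs.1, hs.2⟩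

theorem lintegral_intensity (h : M.Dominated g C) {t : ℝ} (ht : t ∈ Icc 0 M.T) :
    ∫⁻ p, (Ioi t ×ˢ univ).indicator (fun p => ENNReal.ofReal (g p.1 p.2)) p ∂M.intensity
      = ENNReal.ofReal (M.rate * ∫ s in t..M.T, ∫ y, g s y ∂M.claimLaw) := by
  have hmeas : Measurable fun p : ℝ × ℝ => ENNReal.ofReal (g p.1 p.2) :=
    h.measurable.ennreal_ofReal
  have hmeas' := hmeas.indicator (measurableSet_Ioi.prod MeasurableSet.univ : MeasurableSet
    (Ioi t ×ˢ (univ : Set ℝ)))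
  rw [intensity, lintegral_prod _ hmeas'.aemeasurable, lintegral_smul_measure, smul_eq_mul,
    ENNReal.ofReal_mul M.rate.coe_nonneg, ENNReal.ofReal_coe_nnreal]
  congr 1
  have h1 : ∀ s ∈ Icc 0 M.T, ∫⁻ y, (Ioi t ×ˢ univ).indicator
      (fun p => ENNReal.ofReal (g p.1 p.2)) (s, y) ∂M.claimLaw
      = (Ioi t).indicator (fun s => ENNReal.ofReal (∫ y, g s y ∂M.claimLaw)) s := by
    intro s hs
    by_cases hst : t < s
    · simp only [indicator, mem_prod, mem_Ioi, mem_univ, and_true, hst, if_true]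
      rw [ofReal_integral_eq_lintegral_ofReal (h.integrable hs) (h.ae_nonneg hs)]
    · simp [indicator, hst]
  rw [setLIntegral_congr_fun measurableSet_Icc h1, lintegral_indicator measurableSet_Ioi,
    Measure.restrict_restrict measurableSet_Ioi, intervalIntegral.integral_of_le ht.2]
  have h2 : Ioi t ∩ Icc 0 M.T = Ioc t M.T := by
    ext x
    simp only [mem_inter_iff, mem_Ioi, mem_Icc, mem_Ioc]
    exact ⟨fun hx => ⟨hx.1, hx.2.2⟩, fun hx => ⟨hx.1, ht.1.trans hx.1.le, hx.2⟩⟩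
  have h3 : Ioc t M.T ⊆ Icc 0 M.T := fun x hx => ⟨ht.1.trans hx.1.le, hx.2⟩
  rw [h2, ofReal_integral_eq_lintegral_ofReal (h.integrableOn.mono_set h3)]
  filter_upwards [ae_restrict_mem measurableSet_Ioc] with s hs
  exact h.integral_nonneg (h3 hs)

theorem ae_claimSum_nonneg (h : M.Dominated g C) (t : ℝ) :
    ∀ᵐ ω ∂M.P, 0 ≤ M.claimSum t g ω := by
  filter_upwards [M.ae_Y_pos] with ω hY
  exact Finset.sum_nonneg fun i hi =>
    h.nonneg _ (M.claimTime_mem (Finset.mem_Ico.1 hi).2) _ (hY i)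

/-- Among claims arriving by `T`, those with index at least `N t` are exactly those arriving after
`t`. This moves the finite sum into the setting of Campbell's formulas. -/
theorem ae_ofReal_claimSum (h : M.Dominated g C) {t : ℝ} (ht : t ∈ Icc 0 M.T) :
    ∀ᵐ ω ∂M.P, ENNReal.ofReal (M.claimSum t g ω) = M.claimSeries
      ((Ioi t ×ˢ univ).indicator (fun p => ENNReal.ofReal (g p.1 p.2))) ω := by
  filter_upwards [M.ae_Y_pos, M.ae_claimTime_le_iff] with ω hY hτ
  rw [claimSum, claimSeries, ENNReal.ofReal_sum_of_nonneg fun i hi =>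
    h.nonneg _ (M.claimTime_mem (Finset.mem_Ico.1 hi).2) _ (hY i),
    tsum_eq_sum (s := Finset.Ico (M.N t ω) (M.N M.T ω))]
  · refine Finset.sum_congr rfl fun i hi => ?_
    have hi' := Finset.mem_Ico.1 hi
    have h1 : t < M.claimTime i ω := by
      rw [← not_le, hτ i t hi'.2, M.clamp_of_mem ht]
      omega
    simp [indicator, claimPoint, hi'.2, h1]
  · intro i hi
    by_cases hi' : i < M.N M.T ω
    · have h1 : ¬ t < M.claimTime i ω := by
        rw [not_lt, hτ i t hi', M.clamp_of_mem ht]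
        by_contra hlt
        exact hi (Finset.mem_Ico.2 ⟨not_lt.1 hlt, hi'⟩)
      simp [indicator, claimPoint, h1]
    · simp [indicator, hi']

theorem measurable_indicator (h : M.Dominated g C) (t : ℝ) :
    Measurable ((Ioi t ×ˢ univ).indicator (fun p : ℝ × ℝ => ENNReal.ofReal (g p.1 p.2))) :=
  Measurable.indicator (f := fun p : ℝ × ℝ => ENNReal.ofReal (g p.1 p.2))
    h.measurable.ennreal_ofReal (measurableSet_Ioi.prod MeasurableSet.univ)

theorem aestronglyMeasurable_claimSum (h : M.Dominated g C) {t : ℝ} (ht : t ∈ Icc 0 M.T) :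
    AEStronglyMeasurable (M.claimSum t g) M.P := by
  refine ((M.aemeasurable_claimSeries (h.measurable_indicator t)).ennreal_toReal.congr
    ?_).aestronglyMeasurable
  filter_upwards [h.ae_ofReal_claimSum ht, h.ae_claimSum_nonneg t] with ω h1 h2
  rw [← h1, ENNReal.toReal_ofReal h2]

theorem lintegral_claimSum (h : M.Dominated g C) {t : ℝ} (ht : t ∈ Icc 0 M.T) :
    ∫⁻ ω, ENNReal.ofReal (M.claimSum t g ω) ∂M.P
      = ENNReal.ofReal (M.rate * ∫ s in t..M.T, ∫ y, g s y ∂M.claimLaw) := by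
  rw [lintegral_congr_ae (h.ae_ofReal_claimSum ht),
    M.lintegral_claimSeries (h.measurable_indicator t), h.lintegral_intensity ht]

theorem integral_claimSum (h : M.Dominated g C) {t : ℝ} (ht : t ∈ Icc 0 M.T) :
    ∫ ω, M.claimSum t g ω ∂M.P = M.rate * ∫ s in t..M.T, ∫ y, g s y ∂M.claimLaw := by
  rw [integral_eq_lintegral_of_nonneg_ae (h.ae_claimSum_nonneg t)
    (h.aestronglyMeasurable_claimSum ht), h.lintegral_claimSum ht,
    ENNReal.toReal_ofReal (mul_nonneg M.rate.coe_nonneg (h.intervalIntegral_nonneg ht))]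

theorem lintegral_claimSum_sq {C' : ℝ → ℝ} (h : M.Dominated g C)
    (h2 : M.Dominated (fun s y => g s y ^ 2) C') {t : ℝ} (ht : t ∈ Icc 0 M.T) :
    ∫⁻ ω, ENNReal.ofReal (M.claimSum t g ω ^ 2) ∂M.P
      = ENNReal.ofReal (M.rate * (∫ s in t..M.T, ∫ y, g s y ^ 2 ∂M.claimLaw)
        + (M.rate * ∫ s in t..M.T, ∫ y, g s y ∂M.claimLaw) ^ 2) := by
  have h3 : ∫⁻ ω, ENNReal.ofReal (M.claimSum t g ω ^ 2) ∂M.P = ∫⁻ ω, M.claimSeries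
      ((Ioi t ×ˢ univ).indicator (fun p => ENNReal.ofReal (g p.1 p.2))) ω ^ 2 ∂M.P := by
    refine lintegral_congr_ae ?_
    filter_upwards [h.ae_ofReal_claimSum ht, h.ae_claimSum_nonneg t] with ω h4 h5
    rw [← h4, ENNReal.ofReal_pow h5]
  have h0 := mul_nonneg M.rate.coe_nonneg (h.intervalIntegral_nonneg ht)
  rw [h3, M.lintegral_claimSeries_sq (h.measurable_indicator t), h.lintegral_intensity ht,
    ENNReal.ofReal_add (mul_nonneg M.rate.coe_nonneg (h2.intervalIntegral_nonneg ht))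
      (by positivity), ENNReal.ofReal_pow h0, ← h2.lintegral_intensity ht]
  congr 1
  -- `g` is nonnegative only there, and `ENNReal.ofReal` commutes with squaring only for nonnegative
  -- values.
  have hν : ∀ᵐ p ∂M.intensity, p.1 ∈ Icc 0 M.T ∧ 0 < p.2 := by
    rw [intensity, Measure.ae_prod_iff_ae_ae (by measurability)]
    refine Measure.ae_smul_measure ?_ _
    filter_upwards [ae_restrict_mem measurableSet_Icc] with s hs
    filter_upwards [M.ae_claimLaw_pos] with y hy using ⟨hs, hy⟩
  refine lintegral_congr_ae ?_
  filter_upwards [hν] with p hp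
  by_cases hpt : t < p.1
  · simp [indicator, hpt, ENNReal.ofReal_pow (h.nonneg _ hp.1 _ hp.2)]
  · simp [indicator, hpt]

theorem memLp_claimSum {C' : ℝ → ℝ} (h : M.Dominated g C)
    (h2 : M.Dominated (fun s y => g s y ^ 2) C') {t : ℝ} (ht : t ∈ Icc 0 M.T) :
    MemLp (M.claimSum t g) 2 M.P := by
  have hm := h.aestronglyMeasurable_claimSum ht
  rw [memLp_two_iff_integrable_sq hm]
  refine ⟨hm.pow 2, ?_⟩
  rw [hasFiniteIntegral_iff_ofReal (ae_of_all _ fun ω => sq_nonneg _),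
    h.lintegral_claimSum_sq h2 ht]
  exact ENNReal.ofReal_lt_top

theorem variance_claimSum {C' : ℝ → ℝ} (h : M.Dominated g C)
    (h2 : M.Dominated (fun s y => g s y ^ 2) C') {t : ℝ} (ht : t ∈ Icc 0 M.T) :
    variance (M.claimSum t g) M.P
      = M.rate * ∫ s in t..M.T, ∫ y, g s y ^ 2 ∂M.claimLaw := by
  have hm := h.aestronglyMeasurable_claimSum ht
  rw [variance_eq_sub (h.memLp_claimSum h2 ht), h.integral_claimSum ht]
  simp only [Pi.pow_apply]
  rw [integral_eq_lintegral_of_nonneg_ae (ae_of_all _ fun ω => sq_nonneg _) (hm.pow 2),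
    h.lintegral_claimSum_sq h2 ht, ENNReal.toReal_ofReal]
  · ring
  · have := mul_nonneg M.rate.coe_nonneg (h2.intervalIntegral_nonneg ht)
    positivity

end Dominated

end InsuranceModel

/-! ### The customer's problem: cost functional, deductibles and equilibria. -/

namespace InsuranceModel

variable {Ω : Type*} [MeasurableSpace Ω] {M : InsuranceModel Ω} {l : ℝ → ℝ → ℝ}

theorem dominated_coverage (hl : l ∈ M.admissible) : M.Dominated l (fun y => y) where
  measurable := hl.1
  integrable_bound := M.integrable_id_claimLaw
  nonneg s hs y hy := (hl.2 s hs y hy).1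
  le s hs y hy := (hl.2 s hs y hy).2

theorem dominated_coverage_sq (hl : l ∈ M.admissible) :
    M.Dominated (fun s y => l s y ^ 2) (fun y => y ^ 2) where
  measurable := hl.1.pow_const 2
  integrable_bound := M.integrable_sq_claimLaw
  nonneg _ _ _ _ := sq_nonneg _
  le s hs y hy := pow_le_pow_left₀ (hl.2 s hs y hy).1 (hl.2 s hs y hy).2 2

theorem admissible_retained (hl : l ∈ M.admissible) : (fun s y => y - l s y) ∈ M.admissible :=
  ⟨measurable_snd.sub hl.1, fun s hs y hy =>
    ⟨sub_nonneg.2 (hl.2 s hs y hy).2, sub_le_self _ (hl.2 s hs y hy).1⟩⟩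

/-- The customer's cost per claim under the coverage `f`, up to the factor given by the claim
rate. -/
noncomputable def cost (M : InsuranceModel Ω) (γ ξ : ℝ) (f : ℝ → ℝ) : ℝ :=
  ∫ y, (y + ξ * f y + γ / 2 * (y - f y) ^ 2) ∂M.claimLaw

theorem dominated_cost {γ ξ : ℝ} (hγ : 0 ≤ γ) (hξ : 0 ≤ ξ) (hl : l ∈ M.admissible) :
    M.Dominated (fun s y => y + ξ * l s y + γ / 2 * (y - l s y) ^ 2)
      (fun y => y + ξ * y + γ / 2 * y ^ 2) where
  measurable := by
    have := hl.1
    change Measurable fun p : ℝ × ℝ => p.2 + ξ * (Function.uncurry l) p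
      + γ / 2 * (p.2 - (Function.uncurry l) p) ^ 2
    fun_prop
  integrable_bound := (M.integrable_id_claimLaw.add (M.integrable_id_claimLaw.const_mul ξ)).add
    (M.integrable_sq_claimLaw.const_mul (γ / 2))
  nonneg s hs y hy := by
    have := (hl.2 s hs y hy).1
    positivity
  le s hs y hy := by
    obtain ⟨h1, h2⟩ := hl.2 s hs y hy
    have : (y - l s y) ^ 2 ≤ y ^ 2 := pow_le_pow_left₀ (by linarith) (by linarith) 2
    gcongr

theorem cost_eq {γ ξ : ℝ} (hl : l ∈ M.admissible) {s : ℝ} (hs : s ∈ Icc 0 M.T) :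
    M.cost γ ξ (l s) = (1 + ξ) * (∫ y, l s y ∂M.claimLaw) + (∫ y, (y - l s y) ∂M.claimLaw)
      + γ / 2 * ∫ y, (y - l s y) ^ 2 ∂M.claimLaw := by
  have h1 := (dominated_coverage hl).integrable hs
  have h2 := (dominated_coverage (admissible_retained hl)).integrable hs
  have h3 := (dominated_coverage_sq (admissible_retained hl)).integrable hs
  have h12 : Integrable (fun y => (1 + ξ) * l s y + (y - l s y)) M.claimLaw :=
    (h1.const_mul _).add h2
  rw [← integral_const_mul, ← integral_const_mul, ← integral_add (h1.const_mul _) h2,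
    ← integral_add h12 (h3.const_mul _), cost]
  congr 1
  ext y
  ring

/-- Premium, mean and variance of the retained claims are all time integrals, so they merge into one
running cost. The surplus enters only additively. -/
theorem customerCriterion_eq {γ ξ : ℝ} (hl : l ∈ M.admissible) {t : ℝ} (ht : t ∈ Icc 0 M.T)
    (x : ℝ) :
    M.customerCriterion γ ξ t x l = x - M.rate * ∫ s in t..M.T, M.cost γ ξ (l s) := by
  have hr := admissible_retained hl
  have h1 := dominated_coverage hr
  have h2 := dominated_coverage_sq hr
  have hmem := h1.memLp_claimSum h2 ht
  have hint := hmem.integrable (by norm_num)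
  have hc : ∫ s in t..M.T, M.cost γ ξ (l s)
      = (∫ s in t..M.T, ((1 + ξ) * ∫ y, l s y ∂M.claimLaw)
        + ∫ y, (y - l s y) ∂M.claimLaw) + ∫ s in t..M.T,
          γ / 2 * ∫ y, (y - l s y) ^ 2 ∂M.claimLaw := by
    rw [← intervalIntegral.integral_add]
    · refine intervalIntegral.integral_congr fun s hs => ?_
      rw [uIcc_of_le ht.2] at hs
      exact cost_eq hl ⟨ht.1.trans hs.1, hs.2⟩
    · exact (((dominated_coverage hl).intervalIntegrable ht M.T_mem).const_mul _).add
        (h1.intervalIntegrable ht M.T_mem)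
    · exact (h2.intervalIntegrable ht M.T_mem).const_mul _
  rw [hc, intervalIntegral.integral_add
    (((dominated_coverage hl).intervalIntegrable ht M.T_mem).const_mul _)
    (h1.intervalIntegrable ht M.T_mem), intervalIntegral.integral_const_mul,
    intervalIntegral.integral_const_mul, customerCriterion, meanVariance]
  unfold customerSurplus
  rw [variance_const_sub hmem.aestronglyMeasurable, integral_sub (integrable_const _) hint,
    h1.variance_claimSum h2 ht, h1.integral_claimSum ht]
  simp only [premiumRate, intervalIntegral.integral_const_mul, integral_const, probReal_univ,
    smul_eq_mul]
  ring

theorem insurerUtility_eq {γI ξ : ℝ} (hl : l ∈ M.admissible) :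
    M.insurerUtility γI ξ l = M.rate * ∫ s in (0 : ℝ)..M.T,
      (ξ * (∫ y, l s y ∂M.claimLaw) - γI / 2 * ∫ y, l s y ^ 2 ∂M.claimLaw) := by
  have h1 := dominated_coverage hl
  have h2 := dominated_coverage_sq hl
  have hmem := h1.memLp_claimSum h2 M.zero_mem
  have hint := hmem.integrable (by norm_num)
  rw [intervalIntegral.integral_sub ((h1.intervalIntegrable M.zero_mem M.T_mem).const_mul _)
    ((h2.intervalIntegrable M.zero_mem M.T_mem).const_mul _),
    intervalIntegral.integral_const_mul, intervalIntegral.integral_const_mul, insurerUtility,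
    meanVariance]
  unfold insurerWealth
  rw [variance_const_sub hmem.aestronglyMeasurable, integral_sub (integrable_const _) hint,
    h1.variance_claimSum h2 M.zero_mem, h1.integral_claimSum M.zero_mem]
  simp only [premiumRate, intervalIntegral.integral_const_mul, integral_const, probReal_univ,
    smul_eq_mul]
  ring

/-- The deductible coverage with deductible `d`. -/
noncomputable def deductible (d : ℝ) (y : ℝ) : ℝ := max (y - d) 0

theorem measurable_deductible (d : ℝ) : Measurable (deductible d) := by
  unfold deductible; fun_prop

theorem deductible_mem {d : ℝ} (hd : 0 ≤ d) {y : ℝ} (hy : 0 < y) :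
    0 ≤ deductible d y ∧ deductible d y ≤ y :=
  ⟨le_max_right _ _, max_le (by linarith) hy.le⟩

theorem admissible_deductible {d : ℝ} (hd : 0 ≤ d) :
    (fun _ => deductible d) ∈ M.admissible :=
  ⟨(measurable_deductible d).comp measurable_snd, fun _ _ _ hy => deductible_mem hd hy⟩

/-- The deductible coverage minimizes the integrand of the cost, with quadratic growth. -/
theorem sq_sub_deductible_le {γ ξ : ℝ} (hγ : 0 < γ) {y f : ℝ} (hf : 0 ≤ f) :
    γ / 2 * (f - deductible (ξ / γ) y) ^ 2 ≤ (y + ξ * f + γ / 2 * (y - f) ^ 2)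
      - (y + ξ * deductible (ξ / γ) y + γ / 2 * (y - deductible (ξ / γ) y) ^ 2) := by
  have hξ : ξ = γ * (ξ / γ) := by field_simp
  set d := ξ / γ
  rw [hξ, deductible]
  -- Above the deductible the integrand is an exact square around its minimizer; below it the
  -- minimizer is the boundary point `0`, and the slack is `γ (d - y) f ≥ 0`.
  rcases le_total 0 (y - d) with h | h
  · rw [max_eq_left h]
    apply le_of_eq
    ring
  · rw [max_eq_right h]
    have : 0 ≤ γ * (d - y) * f := mul_nonneg (mul_nonneg hγ.le (by linarith)) hf
    linarith

theorem cost_deductible_le {γ ξ : ℝ} (hγ : 0 < γ) (hξ : 0 ≤ ξ) (hl : l ∈ M.admissible) {s : ℝ}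
    (hs : s ∈ Icc 0 M.T) : M.cost γ ξ (deductible (ξ / γ)) ≤ M.cost γ ξ (l s) := by
  refine integral_mono_ae ((dominated_cost hγ.le hξ
    (admissible_deductible (div_nonneg hξ hγ.le))).integrable hs)
    ((dominated_cost hγ.le hξ hl).integrable hs) ?_
  filter_upwards [M.ae_claimLaw_pos] with y hy
  have := sq_sub_deductible_le (ξ := ξ) hγ (y := y) (hl.2 s hs y hy).1
  have h2 : 0 ≤ γ / 2 * (l s y - deductible (ξ / γ) y) ^ 2 := by positivity
  linarith

theorem ae_eq_deductible_of_cost_le {γ ξ : ℝ} (hγ : 0 < γ) (hξ : 0 ≤ ξ) (hl : l ∈ M.admissible)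
    {s : ℝ} (hs : s ∈ Icc 0 M.T) (h : M.cost γ ξ (l s) ≤ M.cost γ ξ (deductible (ξ / γ))) :
    l s =ᵐ[M.claimLaw] deductible (ξ / γ) := by
  have h1 := (dominated_cost hγ.le hξ
    (admissible_deductible (div_nonneg hξ hγ.le))).integrable hs
  have h2 := (dominated_cost hγ.le hξ hl).integrable hs
  have hle : ∀ᵐ y ∂M.claimLaw, γ / 2 * (l s y - deductible (ξ / γ) y) ^ 2 ≤
      (y + ξ * l s y + γ / 2 * (y - l s y) ^ 2) - (y + ξ * deductible (ξ / γ) y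
        + γ / 2 * (y - deductible (ξ / γ) y) ^ 2) := by
    filter_upwards [M.ae_claimLaw_pos] with y hy
    exact sq_sub_deductible_le hγ (hl.2 s hs y hy).1
  have hnn : 0 ≤ᵐ[M.claimLaw] fun y => (y + ξ * l s y + γ / 2 * (y - l s y) ^ 2)
      - (y + ξ * deductible (ξ / γ) y + γ / 2 * (y - deductible (ξ / γ) y) ^ 2) := by
    filter_upwards [hle] with y hy
    exact le_trans (by positivity) hy
  have h0 := (integral_eq_zero_iff_of_nonneg_ae hnn (h2.sub h1)).1 (by
    refine le_antisymm ?_ (integral_nonneg_of_ae hnn)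
    rw [integral_sub h2 h1]
    exact sub_nonpos.2 h)
  filter_upwards [hle, h0] with y hy hy0
  rw [hy0] at hy
  simp only [Pi.zero_apply] at hy
  have h3 : (l s y - deductible (ξ / γ) y) ^ 2 ≤ 0 := by
    by_contra! h4
    have : 0 < γ / 2 * (l s y - deductible (ξ / γ) y) ^ 2 := by positivity
    linarith
  exact sub_eq_zero.1 (pow_eq_zero_iff two_ne_zero |>.1 (le_antisymm h3 (sq_nonneg _)))

theorem isMaxOn_customerCriterion {γ ξ : ℝ} (hγ : 0 < γ) (hξ : 0 ≤ ξ) {t : ℝ}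
    (ht : t ∈ Icc 0 M.T) (x : ℝ) :
    IsMaxOn (M.customerCriterion γ ξ t x) M.admissible (fun _ => deductible (ξ / γ)) := by
  intro l hl
  have hd : (fun _ => deductible (ξ / γ)) ∈ M.admissible :=
    admissible_deductible (div_nonneg hξ hγ.le)
  simp only [mem_ofPred_eq]
  rw [customerCriterion_eq hl ht, customerCriterion_eq hd ht]
  refine sub_le_sub_left (mul_le_mul_of_nonneg_left ?_ M.rate.coe_nonneg) _
  refine intervalIntegral.integral_mono_on ht.2
    ((dominated_cost hγ.le hξ hd).intervalIntegrable ht M.T_mem)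
    ((dominated_cost hγ.le hξ hl).intervalIntegrable ht M.T_mem) fun s hs => ?_
  exact cost_deductible_le hγ hξ hl ⟨ht.1.trans hs.1, hs.2⟩

theorem isEquilibrium_deductible {γ ξ : ℝ} (hγ : 0 < γ) (hξ : 0 ≤ ξ) :
    M.IsEquilibrium γ ξ (fun _ => deductible (ξ / γ)) := by
  refine ⟨admissible_deductible (div_nonneg hξ hγ.le), fun t ht x lbar hadm => ?_⟩
  refine le_liminf_of_le (by isBoundedDefault) ?_
  filter_upwards [self_mem_nhdsWithin] with ε hε
  have := isMaxOn_customerCriterion hγ hξ ht x (hadm ε hε)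
  simp only [mem_ofPred_eq] at this
  exact_mod_cast div_nonneg (sub_nonneg.2 this) (le_of_lt hε)

theorem perturb_of_mem {lbar : ℝ → ℝ} {t ε s : ℝ} (hs : s ∈ Ico t (t + ε)) :
    perturb l lbar t ε s = lbar := by
  ext y
  simp only [perturb, hs, if_true]

theorem perturb_of_notMem {lbar : ℝ → ℝ} {t ε s : ℝ} (hs : s ∉ Ico t (t + ε)) :
    perturb l lbar t ε s = l s := by
  ext y
  simp only [perturb, hs, if_false]

theorem perturb_mem_admissible (hl : l ∈ M.admissible) {lbar : ℝ → ℝ} (hm : Measurable lbar)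
    (hb : ∀ y, 0 < y → 0 ≤ lbar y ∧ lbar y ≤ y) (t ε : ℝ) :
    perturb l lbar t ε ∈ M.admissible := by
  classical
  refine ⟨?_, fun s hs y hy => ?_⟩
  · have : Function.uncurry (perturb l lbar t ε)
        = fun p : ℝ × ℝ => if p.1 ∈ Ico t (t + ε) then lbar p.2 else Function.uncurry l p := by
      ext p
      simp only [Function.uncurry, perturb]
    rw [this]
    exact Measurable.ite (measurable_fst measurableSet_Ico) (hm.comp measurable_snd) hl.1
  · unfold perturb
    split_ifs
    · exact hb y hy
    · exact hl.2 s hs y hy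

/-- The running costs agree after `t + ε` and cancel, leaving only the perturbation window. -/
theorem customerCriterion_sub_perturb {γ ξ : ℝ} (hγ : 0 ≤ γ) (hξ : 0 ≤ ξ)
    (hl : l ∈ M.admissible) {lbar : ℝ → ℝ} {t ε : ℝ}
    (hp : perturb l lbar t ε ∈ M.admissible) (ht : t ∈ Icc 0 M.T) (hε : 0 < ε)
    (htε : t + ε ≤ M.T) (x : ℝ) :
    M.customerCriterion γ ξ t x l - M.customerCriterion γ ξ t x (perturb l lbar t ε)
      = M.rate * (ε * M.cost γ ξ lbar - ∫ s in t..(t + ε), M.cost γ ξ (l s)) := by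
  have hm : t + ε ∈ Icc 0 M.T := ⟨by linarith [ht.1], htε⟩
  have h1 := dominated_cost hγ hξ hl
  have h2 := dominated_cost hγ hξ hp
  have e1 := intervalIntegral.integral_add_adjacent_intervals
    (h1.intervalIntegrable ht hm) (h1.intervalIntegrable hm M.T_mem)
  have e2 := intervalIntegral.integral_add_adjacent_intervals
    (h2.intervalIntegrable ht hm) (h2.intervalIntegrable hm M.T_mem)
  have e3 : ∫ s in t..(t + ε), M.cost γ ξ (perturb l lbar t ε s) = ε * M.cost γ ξ lbar := by
    rw [intervalIntegral.integral_of_le (by linarith), ← integral_Ico_eq_integral_Ioc,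
      setIntegral_congr_fun (g := fun _ => M.cost γ ξ lbar) measurableSet_Ico]
    · simp [hε.le]
    · intro s hs
      exact congrArg (M.cost γ ξ) (perturb_of_mem hs)
  have e4 : ∫ s in (t + ε)..M.T, M.cost γ ξ (perturb l lbar t ε s)
      = ∫ s in (t + ε)..M.T, M.cost γ ξ (l s) := by
    refine intervalIntegral.integral_congr fun s hs => ?_
    rw [uIcc_of_le htε] at hs
    have : s ∉ Ico t (t + ε) := fun h => absurd h.2 (not_lt.2 hs.1)
    exact congrArg (M.cost γ ξ) (perturb_of_notMem this)
  rw [customerCriterion_eq hl ht, customerCriterion_eq hp ht]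
  simp only [cost] at e1 e2 e3 e4 ⊢
  rw [← e1, ← e2, e3, e4]
  ring

/-- Equilibrium coverages are deductible coverages. -/
theorem IsEquilibrium.ae_eq_deductible {γ ξ : ℝ} (hγ : 0 < γ) (hξ : 0 ≤ ξ)
    (h : M.IsEquilibrium γ ξ l) :
    ∀ᵐ s ∂(volume.restrict (Icc 0 M.T)), l s =ᵐ[M.claimLaw] deductible (ξ / γ) := by
  obtain ⟨hl, heq⟩ := h
  have hd := div_nonneg hξ hγ.le
  have h1 := (dominated_cost hγ.le hξ hl).intervalIntegrable M.zero_mem M.T_mem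
  rw [ae_restrict_iff' measurableSet_Icc]
  -- By Lebesgue differentiation the averaged cost over `[t, t + ε)` tends to the cost at `t`, for
  -- almost every `t`. Excluding `T` makes small windows fit into the horizon.
  filter_upwards [h1.ae_hasDerivAt_integral, Measure.ae_ne volume M.T] with t hder htT ht
  refine ae_eq_deductible_of_cost_le hγ hξ hl ht ?_
  have ht' : t < M.T := lt_of_le_of_ne ht.2 htT
  have hadm : ∀ ε, perturb l (deductible (ξ / γ)) t ε ∈ M.admissible := fun ε =>
    perturb_mem_admissible hl (measurable_deductible _) (fun y hy => deductible_mem hd hy) t ε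
  have htu : t ∈ uIcc 0 M.T := by rwa [uIcc_of_le M.T_pos.le]
  have hslope := (hder htu t htu).tendsto_slope_zero_right
  have hlim : Tendsto (fun ε : ℝ => (M.customerCriterion γ ξ t 0 l
      - M.customerCriterion γ ξ t 0 (perturb l (deductible (ξ / γ)) t ε)) / ε) (𝓝[>] 0)
      (𝓝 (M.rate * (M.cost γ ξ (deductible (ξ / γ)) - M.cost γ ξ (l t)))) := by
    refine ((hslope.const_sub (M.cost γ ξ (deductible (ξ / γ)))).const_mul
      (M.rate : ℝ)).congr' ?_
    filter_upwards [Ioo_mem_nhdsGT (sub_pos.2 ht')] with ε hε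
    rw [customerCriterion_sub_perturb hγ.le hξ hl (hadm ε) ht hε.1 (by linarith [hε.2])]
    have hε0 := hε.1.ne'
    have key : ∀ r c I : ℝ, r * (c - ε⁻¹ * I) = r * (ε * c - I) / ε := by
      intro r c I
      field_simp
    simp only [intervalIntegral.integral_same, sub_zero, smul_eq_mul]
    exact key _ _ _
  -- The quotient converges, so the `EReal` liminf is its limit and the equilibrium inequality
  -- compares the costs at `t`.
  have hlimE := (continuous_coe_real_ereal.tendsto _).comp hlim
  have h0 := heq t ht 0 (deductible (ξ / γ)) fun ε _ => hadm ε
  have h2 := hlimE.liminf_eq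
  simp only [Function.comp_def] at h2
  rw [h2] at h0
  have h3 : 0 ≤ M.rate * (M.cost γ ξ (deductible (ξ / γ)) - M.cost γ ξ (l t)) := by
    exact_mod_cast h0
  have h4 := nonneg_of_mul_nonneg_right h3 (by exact_mod_cast M.rate_pos)
  linarith

/-! ### The insurer's utility and premium at an equilibrium response. -/

theorem integral_claimLaw (M : InsuranceModel Ω) {f : ℝ → ℝ} (hf : Measurable f) :
    ∫ y, f y ∂M.claimLaw = ∫ ω, f (M.Y 0 ω) ∂M.P :=
  integral_map (M.Y_measurable 0).aemeasurable hf.aestronglyMeasurable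

theorem IsEquilibrium.insurerUtility_eq {γ γI ξ : ℝ} (hγ : 0 < γ) (hξ : 0 ≤ ξ)
    (h : M.IsEquilibrium γ ξ l) :
    M.insurerUtility γI ξ l = M.rate * M.T * loadingObjective M γ γI ξ := by
  have hae := h.ae_eq_deductible hγ hξ
  rw [InsuranceModel.insurerUtility_eq h.1, intervalIntegral.integral_of_le M.T_pos.le,
    ← integral_Icc_eq_integral_Ioc, integral_congr_ae (g := fun _ => loadingObjective M γ γI ξ)]
  · simp [M.T_pos.le, mul_assoc]
  · filter_upwards [hae] with s hs
    have e1 : ∫ y, l s y ∂M.claimLaw = ∫ y, deductible (ξ / γ) y ∂M.claimLaw :=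
      integral_congr_ae hs
    have e2 : ∫ y, l s y ^ 2 ∂M.claimLaw = ∫ y, deductible (ξ / γ) y ^ 2 ∂M.claimLaw :=
      integral_congr_ae (by filter_upwards [hs] with y hy; rw [hy])
    rw [e1, e2, M.integral_claimLaw (measurable_deductible _),
      M.integral_claimLaw ((measurable_deductible _).pow_const 2)]
    rfl

theorem premiumRate_of_ae_eq {γ ξ s : ℝ} (h : l s =ᵐ[M.claimLaw] deductible (ξ / γ)) :
    M.premiumRate ξ l s = (1 + ξ) * M.rate * ∫ ω, max (M.Y 0 ω - ξ / γ) 0 ∂M.P := by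
  rw [premiumRate, integral_congr_ae h, M.integral_claimLaw (measurable_deductible _)]
  rfl

end InsuranceModel

/-! ### Menus under a point-mass prior. -/

namespace Menu

variable {Ω : Type*} [MeasurableSpace Ω] {M : InsuranceModel Ω}

theorem objective_dirac (m : Menu) (M : InsuranceModel Ω) (γI γ : ℝ) :
    m.objective M γI γ γ (Measure.dirac γ)
      = M.insurerUtility γI (m.loading γ) (m.coverage γ) := by
  simp [objective]

/-- The type interval is a single point, so truth-telling compares a value with itself, and any real
function is integrable against a Dirac mass. -/
theorem isFeasible_dirac_iff {m : Menu} {γI γ : ℝ} :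
    m.IsFeasible M γI γ γ (Measure.dirac γ) ↔
      0 ≤ m.loading γ ∧ M.IsEquilibrium γ (m.loading γ) (m.coverage γ) := by
  refine ⟨fun h => ⟨h.loading_nonneg γ (by simp), h.response γ (by simp)⟩, fun h => ?_⟩
  refine ⟨?_, ?_, ?_, ?_⟩
  · simpa using h.1
  · simpa using h.2
  · intro γ' hγ' γ'' hγ''
    rw [Icc_self, mem_singleton_iff] at hγ' hγ''
    simp [hγ', hγ'']
  · exact (integrable_dirac (by simp)).integrableOn

theorem IsFeasible.objective_eq {m : Menu} {γI γ : ℝ} (hγ : 0 < γ)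
    (h : m.IsFeasible M γI γ γ (Measure.dirac γ)) :
    m.objective M γI γ γ (Measure.dirac γ)
      = M.rate * M.T * loadingObjective M γ γI (m.loading γ) := by
  rw [isFeasible_dirac_iff] at h
  rw [objective_dirac, h.2.insurerUtility_eq hγ h.1]

/-- The menu offering a deductible coverage at the loading `ξ` to all types. -/
noncomputable def deductible (γ ξ : ℝ) : Menu where
  loading _ := ξ
  coverage _ _ := InsuranceModel.deductible (ξ / γ)

theorem isFeasible_deductible {γ γI ξ : ℝ} (hγ : 0 < γ) (hξ : 0 ≤ ξ) :
    (deductible γ ξ).IsFeasible M γI γ γ (Measure.dirac γ) :=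
  isFeasible_dirac_iff.2 ⟨hξ, InsuranceModel.isEquilibrium_deductible hγ hξ⟩

theorem isOptimal_dirac_iff {m : Menu} {γ γI : ℝ} (hγ : 0 < γ) :
    m.IsOptimal M γI γ γ (Measure.dirac γ) ↔ m.IsFeasible M γI γ γ (Measure.dirac γ) ∧
      IsMaxOn (loadingObjective M γ γI) (Ici 0) (m.loading γ) := by
  have hpos : (0 : ℝ) < M.rate * M.T := mul_pos (by exact_mod_cast M.rate_pos) M.T_pos
  refine and_congr_right fun hm => ⟨fun h ξ hξ => ?_, fun h m' hm' => ?_⟩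
  -- Every loading `ξ ≥ 0` is realized by a feasible menu, so optimality among menus tests all of
  -- `Ici 0`.
  · have h1 := isFeasible_deductible (M := M) (γI := γI) hγ hξ
    have h2 := h _ h1
    rw [hm.objective_eq hγ, h1.objective_eq hγ] at h2
    exact le_of_mul_le_mul_left h2 hpos
  · rw [hm.objective_eq hγ, hm'.objective_eq hγ]
    exact mul_le_mul_of_nonneg_left (h (isFeasible_dirac_iff.1 hm').1) hpos.le

end Menu

theorem corollary3p4 {Ω : Type*} [MeasurableSpace Ω] (M : InsuranceModel Ω) (γ γI : ℝ)
    (hγ : 0 < γ) (hγI : 0 < γI) :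
    -- every maximizing loading gives an optimal menu, consisting of the single stated contract
    (∀ ξ : ℝ, 0 ≤ ξ → IsMaxOn (loadingObjective M γ γI) (Ici 0) ξ →
      ∃ m : Menu, m.IsOptimal M γI γ γ (Measure.dirac γ) ∧ m.loading γ = ξ ∧
        m.contracts M γ γ =
          {((fun _ y => max (y - ξ / γ) 0),
            (fun _ => (1 + ξ) * M.rate * ∫ ω, max (M.Y 0 ω - ξ / γ) 0 ∂M.P))} ∧
        IsMaxOn (M.customerCriterion γ ξ 0 M.xC) M.admissible (m.coverage γ)) ∧
    -- conversely, every optimal menu arises in this way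
    (∀ m : Menu, m.IsOptimal M γI γ γ (Measure.dirac γ) →
      0 ≤ m.loading γ ∧ IsMaxOn (loadingObjective M γ γI) (Ici 0) (m.loading γ) ∧
        (∀ᵐ p ∂((volume.restrict (Icc 0 M.T)).prod M.claimLaw),
          m.coverage γ p.1 p.2 = max (p.2 - m.loading γ / γ) 0) ∧
        (∀ᵐ t ∂(volume.restrict (Icc 0 M.T)),
          M.premiumRate (m.loading γ) (m.coverage γ) t =
            (1 + m.loading γ) * M.rate *
              ∫ ω, max (M.Y 0 ω - m.loading γ / γ) 0 ∂M.P)) := by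
  constructor
  · intro ξ hξ hmax
    refine ⟨Menu.deductible γ ξ, (Menu.isOptimal_dirac_iff hγ).2
      ⟨Menu.isFeasible_deductible hγ hξ, hmax⟩, rfl, ?_,
      InsuranceModel.isMaxOn_customerCriterion hγ hξ M.zero_mem M.xC⟩
    rw [Menu.contracts, Icc_self, image_singleton]
    congr 1
    refine Prod.ext rfl ?_
    ext t
    exact InsuranceModel.premiumRate_of_ae_eq (γ := γ) (Filter.EventuallyEq.refl _ _)
  · intro m hm
    obtain ⟨hfeas, hmax⟩ := (Menu.isOptimal_dirac_iff hγ).1 hm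
    obtain ⟨hξ, heq⟩ := Menu.isFeasible_dirac_iff.1 hfeas
    have hae := heq.ae_eq_deductible hγ hξ
    refine ⟨hξ, hmax, ?_, ?_⟩
    · rw [Measure.ae_prod_iff_ae_ae]
      · exact hae
      · exact measurableSet_eq_fun heq.1.1
          ((InsuranceModel.measurable_deductible _).comp measurable_snd)
    · filter_upwards [hae] with t ht using InsuranceModel.premiumRate_of_ae_eq ht
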